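/- Let $S$ be a smooth surface (without boundary) with a volume form $\rho$, i.e. a smooth nowhere vanishing 2-form, which orients $S$ (for example a Riemann surface with a volume form). Let $(M,\bar g,I,J,K)$ be a hyperkähler 4-manifold: $\bar g$ is a smooth Riemannian metric, and $I,J,K$ are smooth $\bar g$-orthogonal almost complex structures, parallel for the Levi-Civita connection $\bar\nabla$ of $\bar g$, with $IJ=K$. Write $\bar\omega_1(X,Y)=\bar g(IX,Y)$, $\bar\omega_2(X,Y)=\bar g(JX,Y)$, $\bar\omega_3(X,Y)=\bar g(KX,Y)$. For a smooth immersion $f:S\to M$ let $g=f^*\bar g$ be the induced metric and $d\mu$ its area form, for the orientation given by $\rho$, and put $\lambda=d\mu/\rho$ and $N_a=f^*\bar\omega_a/\rho$ for $a=1,2,3$. Let $\xi_a$ be the Hamiltonian vector field of $N_a$ on $(S,\rho)$, defined by $\rho(\xi_a,\cdot)=dN_a$. Let $\nabla\lambda$ be the $g$-gradient of $\lambda$, viewed as a vector field along $f$ through $f_*$, and let $H=g^{ij}A(\partial_i,\partial_j)$ be the mean curvature vector, where $A(X,Y)=(\bar\nabla_X f_*Y)^N$ is the second fundamental form of $f$.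 Then for every smooth immersion $f:S\to M$, at every point of $S$, $$I f_*\xi_1+J f_*\xi_2+K f_*\xi_3=\lambda\nabla\lambda+\lambda^2H .$$ Consequently, for every set of times $T\subset\mathbb R$ (for example an interval) and every family $(f_t)_{t\in T}$ of smooth immersions $S\to M$, the family solves the H-flow $\partial_t f=I f_*\xi_1+J f_*\xi_2+K f_*\xi_3$ on $T$ if and only if it solves $\partial_t f=\lambda\nabla\lambda+\lambda^2H$ on $T$. -/

import Mathlib

open Bundle
open scoped Manifold ContDiff

noncomputable section

/-! All manifolds are real, smooth, without boundary and modelled on `EuclideanSpace ℝ (Fin n)`.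
In Mathlib the tangent space `TangentSpace (𝓡 n) p` is a copy of `EuclideanSpace ℝ (Fin n)`,
a vector being identified with its coordinates in the preferred chart `chartAt _ p` at `p`. -/

namespace HFlow

/-! ### Linear algebra -/

/-- The vector `w` with `B (w, v) = ℓ v` for all `v` (it exists and is unique when `B` is a
nondegenerate bilinear form and `ℓ` a linear form on a finite-dimensional space; see
`dualVector_spec` and `dualVector_unique`); zero if there is no such vector. -/
def dualVector {V : Type*} [Zero V] (B : V → V → ℝ) (ℓ : V → ℝ) : V :=
  open Classical in if h : ∃ w, ∀ v, B w v = ℓ v then h.choose else 0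

theorem dualVector_spec {V : Type*} [AddCommGroup V] [Module ℝ V] [FiniteDimensional ℝ V]
    (B : V →ₗ[ℝ] V →ₗ[ℝ] ℝ) (hB : ∀ w, (∀ v, B w v = 0) → w = 0) (ℓ : V →ₗ[ℝ] ℝ) (v : V) :
    B (dualVector (fun w v => B w v) ℓ) v = ℓ v := by
  have hinj : Function.Injective B := by
    rw [injective_iff_map_eq_zero]
    intro w hw
    exact hB w fun v => by rw [hw]; rfl
  have hfr : Module.finrank ℝ V = Module.finrank ℝ (V →ₗ[ℝ] ℝ) :=
    (Subspace.dual_finrank_eq (K := ℝ) (V := V)).symm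
  have hsurj : Function.Surjective B :=
    (LinearMap.injective_iff_surjective_of_finrank_eq_finrank hfr).1 hinj
  obtain ⟨w, hw⟩ := hsurj ℓ
  have h : ∃ w, ∀ v, B w v = ℓ v := ⟨w, fun v => by rw [hw]⟩
  unfold dualVector
  rw [dif_pos h]
  exact h.choose_spec v

theorem dualVector_unique {V : Type*} [AddCommGroup V] [Module ℝ V]
    (B : V →ₗ[ℝ] V →ₗ[ℝ] ℝ) (hB : ∀ w, (∀ v, B w v = 0) → w = 0) (ℓ : V → ℝ) (w : V)
    (hw : ∀ v, B w v = ℓ v) : dualVector (fun w v => B w v) ℓ = w := by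
  have h : ∃ w, ∀ v, B w v = ℓ v := ⟨w, hw⟩
  unfold dualVector
  rw [dif_pos h, ← sub_eq_zero]
  refine hB _ fun v => ?_
  rw [map_sub, LinearMap.sub_apply, hw, h.choose_spec v, sub_self]

/-! ### Tensor fields -/

section Manifold

variable {n : ℕ} {M : Type*} [TopologicalSpace M] [ChartedSpace (EuclideanSpace ℝ (Fin n)) M]

/-- The differential `dφ` at `p` of a real function `φ`. -/
def differential (φ : M → ℝ) (p : M) (v : TangentSpace (𝓡 n) p) : ℝ :=
  mfderiv (𝓡 n) 𝓘(ℝ, ℝ) φ p v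

/-- The `i`-th coordinate vector at `p`, for the preferred chart at `p`. These vectors form a basis
of the tangent space at `p`. -/
def coordVec (p : M) (i : Fin n) : TangentSpace (𝓡 n) p :=
  (EuclideanSpace.single i 1 : EuclideanSpace ℝ (Fin n))

variable [IsManifold (𝓡 n) ∞ M]

variable (n M) in
/-- Smooth Riemannian metrics on `M`. -/
abbrev Metric : Type _ :=
  ContMDiffRiemannianMetric (𝓡 n) ∞ (EuclideanSpace ℝ (Fin n))
    (fun x : M => TangentSpace (𝓡 n) x)

variable (n M) in
/-- Bilinear forms on the tangent spaces (no regularity in the base point is required). -/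
abbrev BilinField : Type _ :=
  ∀ x : M, TangentSpace (𝓡 n) x →L[ℝ] TangentSpace (𝓡 n) x →L[ℝ] ℝ

variable (n M) in
/-- Endomorphisms of the tangent spaces (no regularity in the base point is required). -/
abbrev EndField : Type _ :=
  ∀ x : M, TangentSpace (𝓡 n) x →L[ℝ] TangentSpace (𝓡 n) x

/-- Smoothness of a bilinear form field. -/
def BilinField.IsSmooth (b : BilinField n M) : Prop :=
  ContMDiff (𝓡 n)
    ((𝓡 n).prod 𝓘(ℝ, EuclideanSpace ℝ (Fin n) →L[ℝ] EuclideanSpace ℝ (Fin n) →L[ℝ] ℝ)) ∞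
    (fun x : M => TotalSpace.mk'
      (EuclideanSpace ℝ (Fin n) →L[ℝ] EuclideanSpace ℝ (Fin n) →L[ℝ] ℝ)
      (E := fun x : M => TangentSpace (𝓡 n) x →L[ℝ] TangentSpace (𝓡 n) x →L[ℝ] ℝ) x (b x))

/-- Smoothness of an endomorphism field. -/
def EndField.IsSmooth (J : EndField n M) : Prop :=
  ContMDiff (𝓡 n)
    ((𝓡 n).prod 𝓘(ℝ, EuclideanSpace ℝ (Fin n) →L[ℝ] EuclideanSpace ℝ (Fin n))) ∞
    (fun x : M => TotalSpace.mk' (EuclideanSpace ℝ (Fin n) →L[ℝ] EuclideanSpace ℝ (Fin n))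
      (E := fun x : M => TangentSpace (𝓡 n) x →L[ℝ] TangentSpace (𝓡 n) x) x (J x))

/-! ### The Levi-Civita connection -/

/-- The coordinate vector field near `p` (for the preferred chart at `p`) whose value at `p`
is `u`. Away from the domain of that chart it is zero. -/
def coordField (p : M) (u : TangentSpace (𝓡 n) p) (x : M) : TangentSpace (𝓡 n) x :=
  (trivializationAt (EuclideanSpace ℝ (Fin n)) (TangentSpace (𝓡 n)) p).symmL ℝ x u

/-- The derivative at `p`, in the direction `w`, of the function `g (U, V)`, where `U`, `V` are the
coordinate vector fields with values `u`, `v` at `p`: in coordinates, `w^C ∂_C g_{AB} u^A v^B`. -/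
def metricCoordDeriv (g : Metric n M) (p : M) (w u v : TangentSpace (𝓡 n) p) : ℝ :=
  differential (n := n) (fun x => g.inner x (coordField p u x) (coordField p v x)) p w

/-- The Christoffel symbols of `g` at `p` in the preferred chart at `p`, contracted with `u`
and `v`: the vector `Γ(u, v) = Γ^C_{AB} u^A v^B` with
`g (Γ(u, v), w) = (u^A ∂_A g_{BC} v^B w^C + v^B ∂_B g_{AC} u^A w^C - w^C ∂_C g_{AB} u^A v^B) / 2`
for all `w`. -/
def christoffel (g : Metric n M) (p : M) (u v : TangentSpace (𝓡 n) p) : TangentSpace (𝓡 n) p :=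
  dualVector (fun w w' => g.inner p w w') fun w =>
    (metricCoordDeriv g p u v w + metricCoordDeriv g p v u w - metricCoordDeriv g p w u v) / 2

end Manifold

section Maps

variable {m n : ℕ}
  {S : Type*} [TopologicalSpace S] [ChartedSpace (EuclideanSpace ℝ (Fin m)) S]
  [IsManifold (𝓡 m) ∞ S]
  {M : Type*} [TopologicalSpace M] [ChartedSpace (EuclideanSpace ℝ (Fin n)) M]
  [IsManifold (𝓡 n) ∞ M]

/-- The differential `f_*` of a map, at `p`. -/
abbrev push (f : S → M) (p : S) : TangentSpace (𝓡 m) p →L[ℝ] TangentSpace (𝓡 n) (f p) :=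
  mfderiv (𝓡 m) (𝓡 n) f p

/-- The Levi-Civita covariant derivative `∇̄_u V` at `p`, in the direction `u`, of a vector field
`V` along the map `f : S → M`: in the preferred coordinates `y` at `f p` it is
`u(V^C) + Γ^C_{AB} u(f^A) V^B`. For `f = id` this is the Levi-Civita connection of `(M, g)`. -/
def covDerivAlong (g : Metric n M) (f : S → M) (V : ∀ x : S, TangentSpace (𝓡 n) (f x))
    (p : S) (u : TangentSpace (𝓡 m) p) : TangentSpace (𝓡 n) (f p) :=
  let dV : TangentSpace (𝓡 n) (f p) :=
    mfderiv (𝓡 m) 𝓘(ℝ, EuclideanSpace ℝ (Fin n))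
      (fun x => (trivializationAt (EuclideanSpace ℝ (Fin n)) (TangentSpace (𝓡 n))
        (f p)).continuousLinearMapAt ℝ (f x) (V x)) p u
  dV + christoffel g (f p) (push f p u) (V p)

/-- `f` is a smooth immersion. -/
structure IsSmoothImmersion (m n : ℕ)
    {S : Type*} [TopologicalSpace S] [ChartedSpace (EuclideanSpace ℝ (Fin m)) S]
    {M : Type*} [TopologicalSpace M] [ChartedSpace (EuclideanSpace ℝ (Fin n)) M]
    (f : S → M) : Prop where
  smooth : ContMDiff (𝓡 m) (𝓡 n) ∞ f
  injective : ∀ p, Function.Injective (push (m := m) (n := n) f p)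

/-- The pullback `(f^* b) (u, v) = b (f_* u, f_* v)`. -/
def pullback (f : S → M) (b : BilinField n M) (p : S) (u v : TangentSpace (𝓡 m) p) : ℝ :=
  b (f p) (push f p u) (push f p v)

/-- The induced metric `f^* ḡ`. -/
def inducedMetric (g : Metric n M) (f : S → M) : ∀ p : S,
    TangentSpace (𝓡 m) p → TangentSpace (𝓡 m) p → ℝ :=
  pullback f g.inner

/-- The normal part `w^N` of a vector `w` in `T_{f p} M`: one subtracts from `w` the tangential part
`f_* z`, where `z` satisfies `ḡ (f_* z, f_* v) = ḡ (w, f_* v)` for all `v`. -/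
def normalPart (g : Metric n M) (f : S → M) (p : S) (w : TangentSpace (𝓡 n) (f p)) :
    TangentSpace (𝓡 n) (f p) :=
  w - push f p (dualVector (fun z v : TangentSpace (𝓡 m) p => inducedMetric g f p z v)
    fun v : TangentSpace (𝓡 m) p => g.inner (f p) w (push f p v))

/-- The second fundamental form `A (u, v) = (∇̄_u f_* V)^N` of `f` at `p`, where `V` is the
coordinate vector field near `p` with value `v` at `p`. -/
def secondFundamentalForm (g : Metric n M) (f : S → M) (p : S) (u v : TangentSpace (𝓡 m) p) :
    TangentSpace (𝓡 n) (f p) :=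
  normalPart (m := m) g f p (covDerivAlong g f (fun x => push f x (coordField p v x)) p u)

/-- The mean curvature vector `H = g^{ij} A (∂_i, ∂_j)` of `f` at `p`, where `g = f^* ḡ`. -/
def meanCurvature (g : Metric n M) (f : S → M) (p : S) : TangentSpace (𝓡 n) (f p) :=
  ∑ i, ∑ j,
    (Matrix.of fun k l : Fin m => inducedMetric g f p (coordVec p k) (coordVec p l))⁻¹ i j •
      secondFundamentalForm g f p (coordVec p i) (coordVec p j)

/-- The gradient `∇φ` of a function `φ` on `S` for the induced metric. -/
def gradient (g : Metric n M) (f : S → M) (φ : S → ℝ) (p : S) : TangentSpace (𝓡 m) p :=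
  dualVector (fun z v => inducedMetric g f p z v) (differential φ p)

end Maps

/-! ### Hyperkähler manifolds -/

section Hyperkahler

variable {n : ℕ} {M : Type*} [TopologicalSpace M] [ChartedSpace (EuclideanSpace ℝ (Fin n)) M]
  [IsManifold (𝓡 n) ∞ M]

/-- The endomorphism field `J` is parallel: `∇_u (J Y) = J (∇_u Y)` for every vector field `Y` that
is differentiable at the point considered. -/
def IsParallel (g : Metric n M) (J : EndField n M) : Prop :=
  ∀ (p : M) (u : TangentSpace (𝓡 n) p) (Y : ∀ x : M, TangentSpace (𝓡 n) x),
    MDifferentiableAt (𝓡 n) ((𝓡 n).prod 𝓘(ℝ, EuclideanSpace ℝ (Fin n)))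
      (fun x => TotalSpace.mk' (EuclideanSpace ℝ (Fin n)) x (Y x)) p →
    covDerivAlong g (id : M → M) (fun x => J x (Y x)) p u
      = J p (covDerivAlong g (id : M → M) Y p u)

/-- `J` is a Kähler structure on the Riemannian manifold `(M, g)`: a smooth orthogonal almost
complex structure, parallel for the Levi-Civita connection. -/
structure IsKahler (g : Metric n M) (J : EndField n M) : Prop where
  smooth : EndField.IsSmooth J
  sq : ∀ x v, J x (J x v) = -v
  orthogonal : ∀ x v w, g.inner x (J x v) (J x w) = g.inner x v w
  parallel : IsParallel g J

/-- The Kähler form `ω (X, Y) = g (J X, Y)`. -/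
def kahlerForm (g : Metric n M) (J : EndField n M) : BilinField n M :=
  fun x => (g.inner x).comp (J x)

end Hyperkahler

/-- A hyperkähler structure `(g, I, J, K)` on the 4-manifold `M`. -/
structure HyperkahlerStructure (M : Type*) [TopologicalSpace M]
    [ChartedSpace (EuclideanSpace ℝ (Fin 4)) M] [IsManifold (𝓡 4) ∞ M] where
  metric : Metric 4 M
  I : EndField 4 M
  J : EndField 4 M
  K : EndField 4 M
  kahler_I : IsKahler metric I
  kahler_J : IsKahler metric J
  kahler_K : IsKahler metric K
  mul_eq : ∀ x v, I x (J x v) = K x v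

/-- A volume form on the surface `S`: a smooth nowhere vanishing 2-form. It orients `S`. -/
structure VolumeForm (S : Type*) [TopologicalSpace S]
    [ChartedSpace (EuclideanSpace ℝ (Fin 2)) S] [IsManifold (𝓡 2) ∞ S] where
  form : BilinField 2 S
  smooth : BilinField.IsSmooth form
  alternating : ∀ x v, form x v v = 0
  ne_zero : ∀ x, form x ≠ 0

section Flow

variable
  {S : Type*} [TopologicalSpace S] [ChartedSpace (EuclideanSpace ℝ (Fin 2)) S]
  [IsManifold (𝓡 2) ∞ S]
  {M : Type*} [TopologicalSpace M] [ChartedSpace (EuclideanSpace ℝ (Fin 4)) M]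
  [IsManifold (𝓡 4) ∞ M]

/-- The function `N = f^* ω / ρ` (quotient of 2-forms on a surface), where `ω` is the Kähler form
of `J`. -/
def kahlerRatio (ρ : VolumeForm S) (g : Metric 4 M) (J : EndField 4 M) (f : S → M) (p : S) : ℝ :=
  pullback f (kahlerForm g J) p (coordVec (n := 2) p 0) (coordVec (n := 2) p 1)
    / ρ.form p (coordVec (n := 2) p 0) (coordVec (n := 2) p 1)

/-- The induced area form `dμ` of an immersion, for the orientation given by `ρ`:
`dμ (u, v)` is the `f^* ḡ`-area of the parallelogram spanned by `u` and `v`, with the sign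
of `ρ (u, v)`. -/
def areaForm (ρ : VolumeForm S) (g : Metric 4 M) (f : S → M) (p : S)
    (u v : TangentSpace (𝓡 2) p) : ℝ :=
  (SignType.sign (ρ.form p u v) : ℝ) *
    Real.sqrt (inducedMetric g f p u u * inducedMetric g f p v v - inducedMetric g f p u v ^ 2)

/-- The function `λ = dμ / ρ`. -/
def areaRatio (ρ : VolumeForm S) (g : Metric 4 M) (f : S → M) (p : S) : ℝ :=
  areaForm ρ g f p (coordVec (n := 2) p 0) (coordVec (n := 2) p 1) / ρ.form p (coordVec (n := 2) p 0) (coordVec (n := 2) p 1)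

/-- The Hamiltonian vector field `ξ` of the function `N` on `(S, ρ)`: `ρ (ξ, ·) = dN`. -/
def hamiltonianField (ρ : VolumeForm S) (N : S → ℝ) (p : S) : TangentSpace (𝓡 2) p :=
  dualVector (fun z v => ρ.form p z v) (differential N p)

/-- The right-hand side `I f_* ξ₁ + J f_* ξ₂ + K f_* ξ₃` of the H-flow. -/
def hFlowVelocity (ρ : VolumeForm S) (h : HyperkahlerStructure M) (f : S → M) (p : S) :
    TangentSpace (𝓡 4) (f p) :=
  h.I (f p) (push f p (hamiltonianField ρ (kahlerRatio ρ h.metric h.I f) p))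
    + h.J (f p) (push f p (hamiltonianField ρ (kahlerRatio ρ h.metric h.J f) p))
    + h.K (f p) (push f p (hamiltonianField ρ (kahlerRatio ρ h.metric h.K f) p))

/-- The vector field `λ ∇λ + λ² H` along `f`, where `∇λ` is viewed in `TM` through `f_*`. -/
def meanCurvatureVelocity (ρ : VolumeForm S) (g : Metric 4 M) (f : S → M) (p : S) :
    TangentSpace (𝓡 4) (f p) :=
  areaRatio ρ g f p • push f p (gradient (m := 2) g f (areaRatio ρ g f) p)
    + areaRatio ρ g f p ^ 2 • meanCurvature (m := 2) g f p

/-- The family `F t` satisfies, at all times `t` in the set `T`, the evolution equation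
`∂F/∂t = X (F t)`. At end points of a time interval the derivative is one-sided. -/
def SolvesFlow (X : ∀ (f : S → M) (p : S), TangentSpace (𝓡 4) (f p)) (T : Set ℝ)
    (F : ℝ → S → M) : Prop :=
  ∀ t ∈ T, ∀ p : S, HasMFDerivWithinAt 𝓘(ℝ, ℝ) (𝓡 4) (fun s => F s p) T t
    ((1 : ℝ →L[ℝ] ℝ).smulRight (X (F t) p))

end Flow

end HFlow

end

/-! Write `eᵢ = f_* ∂ᵢ` and `Dᵢⱼ = ∇̄ᵢ eⱼ`, which is symmetric in `i`, `j`, and let `X` be the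
velocity of the H-flow. On a 4-dimensional space with a linear hyperhermitian structure, `x`, `I x`,
`J x`, `K x` is an orthogonal frame, so that
`∑ₐ ω̄ₐ(x, v) ω̄ₐ(x, w) = |x|² ⟨v, w⟩ - ⟨x, v⟩ ⟨x, w⟩`. With `x = e₀` and `v = w = e₁` this reads
`λ² = ∑ₐ Nₐ²`, whence `⟨X, f_* v⟩ = ∑ₐ Nₐ ρ(ξₐ, v) = ∑ₐ Nₐ dNₐ(v) = λ dλ(v)`: the tangential parts
agree.

For `ν` normal to `f`, put `r = ρ(∂₀, ∂₁)`. Then `r ξₐ = dNₐ(∂₁) ∂₀ - dNₐ(∂₀) ∂₁`, and since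
`ω̄ₐ` is parallel, `r dNₐ(u) = ω̄ₐ(∇̄ᵤ e₀, e₁) + ω̄ₐ(e₀, ∇̄ᵤ e₁) - Nₐ dr(u)`. The terms in `dr` drop
out of `r² ⟨X, ν⟩`, as `∑ₐ Nₐ ω̄ₐ(eᵢ, ν) = 0` by the identity above; its polarization in `x`
collapses the others to `⟨|e₀|² D₁₁ - 2 ⟨e₀, e₁⟩ D₀₁ + |e₁|² D₀₀, ν⟩`, which is the Gram determinant
`λ² r²` times `⟨H, ν⟩`. -/

namespace HFlow

noncomputable section

open scoped Topology

local notation "𝔼" n:max => EuclideanSpace ℝ (Fin n)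

local notation "∂ₛ" => coordVec (n := 2)

section LinearAlgebra

variable {V : Type*} [AddCommGroup V] [Module ℝ V]

theorem sum_smul_eq_of_orthogonal_frame {ι : Type*} [Fintype ι] [Nonempty ι] [DecidableEq ι]
    {G : LinearMap.BilinForm ℝ V} {b : ι → V} {c : ℝ} (hc : c ≠ 0)
    (hcard : Fintype.card ι = Module.finrank ℝ V)
    (hb : ∀ i j, G (b i) (b j) = if i = j then c else 0) (v : V) :
    ∑ i, G v (b i) • b i = c • v := by
  have hli : LinearIndependent ℝ b :=
    LinearMap.linearIndependent_of_isOrthoᵢ (B := G)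
      (fun i j hij => (hb i j).trans (if_neg hij)) (fun i hi => hc (by simpa [hb i i] using hi))
  let basis := basisOfLinearIndependentOfCardEqFinrank hli hcard
  have hv : v = ∑ i, basis.repr v i • b i := by
    simpa [basis] using (basis.sum_repr v).symm
  have hcoord (i : ι) : G v (b i) = c * basis.repr v i := by
    conv_lhs => rw [hv]
    simp [hb, mul_comm]
  simp only [hcoord, mul_smul, ← Finset.smul_sum, ← hv]

/-- A linear hyperhermitian structure: a positive definite bilinear form `G` together with
`G`-orthogonal complex structures `J 0`, `J 1` and `J 2 = J 0 ∘ J 1`. -/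
structure IsHyperhermitian (G : LinearMap.BilinForm ℝ V) (J : Fin 3 → V →ₗ[ℝ] V) : Prop where
  symm : ∀ v w, G v w = G w v
  pos : ∀ v, v ≠ 0 → 0 < G v v
  sq : ∀ a v, J a (J a v) = -v
  orthogonal : ∀ a v w, G (J a v) (J a w) = G v w
  mul_eq : ∀ v, J 0 (J 1 v) = J 2 v

namespace IsHyperhermitian

variable {G : LinearMap.BilinForm ℝ V} {J : Fin 3 → V →ₗ[ℝ] V}

theorem skew (h : IsHyperhermitian G J) (a : Fin 3) (v w : V) : G (J a v) w = -G v (J a w) := by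
  rw [← h.orthogonal a v (J a w), h.sq, map_neg, neg_neg]

theorem apply_self_eq_zero (h : IsHyperhermitian G J) (a : Fin 3) (v : V) : G (J a v) v = 0 := by
  have := h.skew a v v
  rw [h.symm v] at this
  linarith

theorem orthogonal_frame (h : IsHyperhermitian G J) (x : V) (i j : Fin 4) :
    G (![x, J 0 x, J 1 x, J 2 x] i) (![x, J 0 x, J 1 x, J 2 x] j)
      = if i = j then G x x else 0 := by
  have h01 : G (J 0 x) (J 1 x) = 0 := by
    rw [h.skew, h.mul_eq, h.symm, h.apply_self_eq_zero, neg_zero]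
  have h02 : G (J 0 x) (J 2 x) = 0 := by
    rw [← h.mul_eq, h.orthogonal, h.symm, h.apply_self_eq_zero]
  have h12 : G (J 1 x) (J 2 x) = 0 := by
    rw [← h.mul_eq, h.symm, h.apply_self_eq_zero]
  have h0 (a : Fin 3) : G x (J a x) = 0 := (h.symm _ _).trans (h.apply_self_eq_zero a x)
  fin_cases i <;> fin_cases j <;>
    simp [h0, h01, h02, h12, h.apply_self_eq_zero, h.orthogonal, h.symm (J 1 x) (J 0 x),
      h.symm (J 2 x)]

theorem sum_kahler_smul (h : IsHyperhermitian G J) (hV : Module.finrank ℝ V = 4) (x v : V) :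
    ∑ a, G (J a x) v • J a x = G x x • v - G x v • x := by
  rcases eq_or_ne x 0 with rfl | hx
  · simp
  have hframe := sum_smul_eq_of_orthogonal_frame (h.pos x hx).ne' (by simp [hV])
    (h.orthogonal_frame x) v
  rw [eq_sub_iff_add_eq', ← hframe]
  simp [Fin.sum_univ_four, Fin.sum_univ_three, h.symm v, add_assoc]

theorem sum_kahler_mul (h : IsHyperhermitian G J) (hV : Module.finrank ℝ V = 4) (x v w : V) :
    ∑ a, G (J a x) v * G (J a x) w = G x x * G v w - G x v * G x w := by
  simpa using congr_arg (fun z => G z w) (h.sum_kahler_smul hV x v)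

theorem sum_kahler_mul_polarized (h : IsHyperhermitian G J) (hV : Module.finrank ℝ V = 4)
    (x y v w : V) :
    ∑ a, (G (J a x) v * G (J a y) w + G (J a y) v * G (J a x) w)
      = 2 * G x y * G v w - G x v * G y w - G y v * G x w := by
  have hsum := h.sum_kahler_mul hV (x + y) v w
  have hx := h.sum_kahler_mul hV x v w
  have hy := h.sum_kahler_mul hV y v w
  simp only [map_add, LinearMap.add_apply, Fin.sum_univ_three, h.symm y x] at *
  linear_combination hsum - hx - hy

end IsHyperhermitian

end LinearAlgebra

section Coordinates

variable {n : ℕ} {M : Type*} [TopologicalSpace M] [ChartedSpace (𝔼 n) M]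

theorem eventually_mem_chart_source {X : Type*} [TopologicalSpace X] {f : X → M} {p : X}
    (hf : ContinuousAt f p) : ∀ᶠ x in 𝓝 p, f x ∈ (chartAt (𝔼 n) (f p)).source :=
  hf.eventually_mem ((chartAt _ (f p)).open_source.mem_nhds (mem_chart_source _ (f p)))

variable [IsManifold (𝓡 n) ∞ M]

/-- The coordinates, in the preferred chart at `q`, of tangent vectors at `x`. -/
abbrev toCoord (q x : M) : TangentSpace (𝓡 n) x →L[ℝ] 𝔼 n :=
  (trivializationAt (𝔼 n) (TangentSpace (𝓡 n)) q).continuousLinearMapAt ℝ x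

/-- The tangent vector at `x` with given coordinates in the preferred chart at `q`, so that
`coordField q u x = ofCoord q x u`. -/
abbrev ofCoord (q x : M) : 𝔼 n →L[ℝ] TangentSpace (𝓡 n) x :=
  (trivializationAt (𝔼 n) (TangentSpace (𝓡 n)) q).symmL ℝ x

theorem toCoord_apply {q x : M} (hx : x ∈ (chartAt (𝔼 n) q).source) (v : TangentSpace (𝓡 n) x) :
    toCoord q x v = (trivializationAt (𝔼 n) (TangentSpace (𝓡 n)) q ⟨x, v⟩).2 := by
  rw [toCoord, Trivialization.continuousLinearMapAt_apply,
    Trivialization.coe_linearMapAt_of_mem _ (by simpa using hx)]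

theorem ofCoord_toCoord {q x : M} (hx : x ∈ (chartAt (𝔼 n) q).source)
    (v : TangentSpace (𝓡 n) x) : ofCoord q x (toCoord q x v) = v :=
  Trivialization.symmL_continuousLinearMapAt _ (by simpa using hx) v

theorem toCoord_ofCoord {q x : M} (hx : x ∈ (chartAt (𝔼 n) q).source) (v : 𝔼 n) :
    toCoord q x (ofCoord q x v) = v :=
  Trivialization.continuousLinearMapAt_symmL _ (by simpa using hx) v

theorem toCoord_self (q : M) (v : TangentSpace (𝓡 n) q) : toCoord q q v = v := by
  have : IsManifold (𝓡 n) 1 M := IsManifold.of_le (n := ∞) (by simp)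
  rw [toCoord, TangentBundle.continuousLinearMapAt_trivializationAt (mem_chart_source _ q),
    mfderiv_extChartAt_self]
  rfl

theorem coordField_self (q : M) (v : TangentSpace (𝓡 n) q) : coordField q v q = v :=
  (toCoord_self q _).symm.trans (toCoord_ofCoord (mem_chart_source _ q) v)

/-- The bilinear form field `b` in the preferred chart at `q`. -/
def coordForm (b : BilinField n M) (q x : M) : 𝔼 n →L[ℝ] 𝔼 n →L[ℝ] ℝ :=
  (ofCoord q x).precomp ℝ ∘L b x ∘L ofCoord q x

/-- The endomorphism field `J` in the preferred chart at `q`. -/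
def coordEnd (J : EndField n M) (q x : M) : 𝔼 n →L[ℝ] 𝔼 n :=
  toCoord q x ∘L J x ∘L ofCoord q x

theorem coordForm_self (b : BilinField n M) (q : M) (u v : TangentSpace (𝓡 n) q) :
    coordForm b q q u v = b q u v :=
  congr_arg₂ (fun u v => b q u v) (coordField_self q u) (coordField_self q v)

theorem coordEnd_self (J : EndField n M) (q : M) (u : TangentSpace (𝓡 n) q) :
    coordEnd J q q u = J q u :=
  (toCoord_self q _).trans (congr_arg (J q) (coordField_self q u))

theorem BilinField.IsSmooth.mdifferentiableAt_coordForm {b : BilinField n M} (hb : b.IsSmooth)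
    (q : M) :
    MDifferentiableAt (𝓡 n) 𝓘(ℝ, 𝔼 n →L[ℝ] 𝔼 n →L[ℝ] ℝ) (coordForm b q) q := by
  have h := ((contMDiffAt_hom_bundle _).1 (hb q)).2.mdifferentiableAt (by simp)
  refine h.congr_of_eventuallyEq ?_
  filter_upwards [eventually_mem_chart_source (n := n) continuousAt_id] with x hx
  ext u v
  have hx' : x ∈ (trivializationAt (𝔼 n) (TangentSpace (𝓡 n)) q).baseSet := by simpa using hx
  rw [inCoordinates_apply_eq₂ hx' hx' (Set.mem_univ x), ← Trivialization.symmL_apply (R := ℝ) _ hx',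
    ← Trivialization.symmL_apply (R := ℝ) _ hx']
  exact (LinearMap.congr_fun (Trivial.linearMapAt_trivialization ℝ M ℝ x) _).symm

theorem EndField.IsSmooth.mdifferentiableAt_coordEnd {J : EndField n M} (hJ : J.IsSmooth)
    (q : M) : MDifferentiableAt (𝓡 n) 𝓘(ℝ, 𝔼 n →L[ℝ] 𝔼 n) (coordEnd J q) q :=
  ((contMDiffAt_hom_bundle _).1 (hJ q)).2.mdifferentiableAt (by simp)

theorem mdifferentiableAt_coordField (q : M) (v : 𝔼 n) :
    MDifferentiableAt (𝓡 n) (𝓡 n).tangent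
      (fun x => (⟨x, coordField q v x⟩ : TangentBundle (𝓡 n) M)) q := by
  refine (mdifferentiableAt_section _ _).2 ?_
  refine (mdifferentiableAt_const (c := v)).congr_of_eventuallyEq ?_
  filter_upwards [eventually_mem_chart_source (n := n) continuousAt_id] with x hx
  exact (toCoord_apply hx _).symm.trans (toCoord_ofCoord hx v)

end Coordinates

section ProductRule

variable {H E X : Type*} [NormedAddCommGroup E] [NormedSpace ℝ E] [TopologicalSpace H]
  {I : ModelWithCorners ℝ E H} [TopologicalSpace X] [ChartedSpace H X]
  {F F₁ F₂ : Type*} [NormedAddCommGroup F] [NormedSpace ℝ F] [NormedAddCommGroup F₁]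
  [NormedSpace ℝ F₁] [NormedAddCommGroup F₂] [NormedSpace ℝ F₂] {p : X}

theorem mvfderiv_clm_apply {A : X → F₁ →L[ℝ] F} {v : X → F₁}
    (hA : MDifferentiableAt I 𝓘(ℝ, F₁ →L[ℝ] F) A p) (hv : MDifferentiableAt I 𝓘(ℝ, F₁) v p)
    (u : TangentSpace I p) :
    mvfderiv I (fun x => A x (v x)) p u
      = mvfderiv I A p u (v p) + A p (mvfderiv I v p u) := by
  have hpair : HasMFDerivAt I 𝓘(ℝ, (F₁ →L[ℝ] F) × F₁) (fun x => (A x, v x)) p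
      ((mvfderiv I A p).prod (mvfderiv I v p)) :=
    ⟨hA.continuousAt.prodMk hv.continuousAt, hA.hasMFDerivAt.2.prodMk hv.hasMFDerivAt.2⟩
  have hcomp := ((isBoundedBilinearMap_apply (𝕜 := ℝ) (E := F₁) (F := F)).hasFDerivAt
    (A p, v p)).hasMFDerivAt.comp p hpair
  exact (DFunLike.congr_fun hcomp.mfderiv u).trans (add_comm _ _)

theorem mvfderiv_clm_apply₂ {B : X → F₁ →L[ℝ] F₂ →L[ℝ] F} {v : X → F₁} {w : X → F₂}
    (hB : MDifferentiableAt I 𝓘(ℝ, F₁ →L[ℝ] F₂ →L[ℝ] F) B p)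
    (hv : MDifferentiableAt I 𝓘(ℝ, F₁) v p) (hw : MDifferentiableAt I 𝓘(ℝ, F₂) w p)
    (u : TangentSpace I p) :
    mvfderiv I (fun x => B x (v x) (w x)) p u
      = mvfderiv I B p u (v p) (w p) + B p (mvfderiv I v p u) (w p)
        + B p (v p) (mvfderiv I w p u) := by
  rw [mvfderiv_clm_apply (hB.clm_apply hv) hw, mvfderiv_clm_apply hB hv, add_apply]

end ProductRule

section Connection

variable {n : ℕ} {M : Type*} [TopologicalSpace M] [ChartedSpace (𝔼 n) M]
  [IsManifold (𝓡 n) ∞ M] (g : Metric n M) (q : M)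

theorem Metric.mdifferentiableAt_coordForm :
    MDifferentiableAt (𝓡 n) 𝓘(ℝ, 𝔼 n →L[ℝ] 𝔼 n →L[ℝ] ℝ) (coordForm g.inner q) q :=
  BilinField.IsSmooth.mdifferentiableAt_coordForm g.contMDiff q

theorem metricCoordDeriv_eq (w u v : TangentSpace (𝓡 n) q) :
    metricCoordDeriv g q w u v = mvfderiv (𝓡 n) (coordForm g.inner q) q w u v := by
  have hB := Metric.mdifferentiableAt_coordForm g q
  have hconst (u v : 𝔼 n) : mvfderiv (𝓡 n) (fun x => coordForm g.inner q x u v) q w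
      = mvfderiv (𝓡 n) (coordForm g.inner q) q w u v := by
    rw [mvfderiv_clm_apply₂ hB mdifferentiableAt_const mdifferentiableAt_const]
    simp only [mvfderiv_const, zero_apply, map_zero, add_zero]
  exact hconst u v

theorem metricCoordDeriv_comm (w u v : TangentSpace (𝓡 n) q) :
    metricCoordDeriv g q w u v = metricCoordDeriv g q w v u := by
  simp only [metricCoordDeriv, g.symm]

theorem eq_zero_of_inner_eq_zero {w : TangentSpace (𝓡 n) q} (h : ∀ v, g.inner q w v = 0) :
    w = 0 := by
  by_contra hw
  exact (g.pos q w hw).ne' (h w)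

theorem inner_christoffel (u v w : TangentSpace (𝓡 n) q) :
    g.inner q (christoffel g q u v) w
      = (metricCoordDeriv g q u v w + metricCoordDeriv g q v u w
          - metricCoordDeriv g q w u v) / 2 := by
  have : FiniteDimensional ℝ (TangentSpace (𝓡 n) q) := inferInstanceAs (FiniteDimensional ℝ (𝔼 n))
  let dg : 𝔼 n →L[ℝ] 𝔼 n →L[ℝ] 𝔼 n →L[ℝ] ℝ := mvfderiv (𝓡 n) (coordForm g.inner q) q
  let koszul : TangentSpace (𝓡 n) q →L[ℝ] ℝ := (2⁻¹ : ℝ) • (dg u v + dg v u - (dg.flip u).flip v :)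
  have hkoszul (w : TangentSpace (𝓡 n) q) : koszul w = (metricCoordDeriv g q u v w
      + metricCoordDeriv g q v u w - metricCoordDeriv g q w u v) / 2 := by
    rw [metricCoordDeriv_eq, metricCoordDeriv_eq, metricCoordDeriv_eq, div_eq_inv_mul]
    rfl
  rw [christoffel, ← hkoszul, ← funext hkoszul]
  exact dualVector_spec (g.inner q).toLinearMap₁₂ (fun w => eq_zero_of_inner_eq_zero g q)
    koszul.toLinearMap w

theorem christoffel_comm (u v : TangentSpace (𝓡 n) q) :
    christoffel g q u v = christoffel g q v u := by
  simp only [christoffel, metricCoordDeriv_comm g q _ u v, add_comm]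

theorem metricCoordDeriv_eq_christoffel (u v w : TangentSpace (𝓡 n) q) :
    metricCoordDeriv g q u v w
      = g.inner q (christoffel g q u v) w + g.inner q v (christoffel g q u w) := by
  rw [g.symm q v, inner_christoffel, inner_christoffel, metricCoordDeriv_comm g q v,
    metricCoordDeriv_comm g q w, metricCoordDeriv_comm g q u w]
  ring

end Connection

section AlongMap

variable {m n : ℕ} {S : Type*} [TopologicalSpace S] [ChartedSpace (𝔼 m) S]
  {M : Type*} [TopologicalSpace M] [ChartedSpace (𝔼 n) M] [IsManifold (𝓡 n) ∞ M]
  {f : S → M} {p : S} {V W : ∀ x, TangentSpace (𝓡 n) (f x)}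

/-- The vector field `V` along the map `f` is differentiable at `p`, as a map to `TM`. -/
abbrev DifferentiableAlong (f : S → M) (V : ∀ x, TangentSpace (𝓡 n) (f x)) (p : S) : Prop :=
  MDifferentiableAt (𝓡 m) (𝓡 n).tangent (fun x => (⟨f x, V x⟩ : TangentBundle (𝓡 n) M)) p

theorem differentiableAlong_iff : DifferentiableAlong (m := m) f V p ↔
    MDifferentiableAt (𝓡 m) (𝓡 n) f p ∧
      MDifferentiableAt (𝓡 m) 𝓘(ℝ, 𝔼 n) (fun x => toCoord (f p) (f x) (V x)) p := by
  refine (mdifferentiableAt_totalSpace _ _).trans (and_congr_right fun hf => ?_)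
  refine Filter.EventuallyEq.mdifferentiableAt_iff ?_
  filter_upwards [eventually_mem_chart_source (n := n) hf.continuousAt] with x hx
  exact (toCoord_apply hx _).symm

/-- The derivative of the components of the vector field `V` along `f` in the preferred chart at
`f p`: the part of `covDerivAlong` without Christoffel symbols. -/
def coordDerivAlong (f : S → M) (V : ∀ x, TangentSpace (𝓡 n) (f x)) (p : S)
    (u : TangentSpace (𝓡 m) p) : TangentSpace (𝓡 n) (f p) :=
  mfderiv (𝓡 m) 𝓘(ℝ, 𝔼 n) (fun x => toCoord (f p) (f x) (V x)) p u

theorem covDerivAlong_eq (g : Metric n M) (u : TangentSpace (𝓡 m) p) :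
    covDerivAlong g f V p u = coordDerivAlong f V p u + christoffel g (f p) (push f p u) (V p) :=
  rfl

theorem inner_along_eventuallyEq (g : Metric n M) (hf : ContinuousAt f p) :
    (fun x => g.inner (f x) (V x) (W x)) =ᶠ[𝓝 p] fun x =>
      coordForm g.inner (f p) (f x) (toCoord (f p) (f x) (V x)) (toCoord (f p) (f x) (W x)) := by
  filter_upwards [eventually_mem_chart_source (n := n) hf] with x hx
  exact (congr_arg₂ (fun v w => g.inner (f x) v w) (ofCoord_toCoord hx (V x))
    (ofCoord_toCoord hx (W x))).symm

theorem mdifferentiableAt_inner_along (g : Metric n M) (hV : DifferentiableAlong (m := m) f V p)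
    (hW : DifferentiableAlong (m := m) f W p) :
    MDifferentiableAt (𝓡 m) 𝓘(ℝ, ℝ) (fun x => g.inner (f x) (V x) (W x)) p := by
  obtain ⟨hf, hv⟩ := differentiableAlong_iff.1 hV
  have hw := (differentiableAlong_iff.1 hW).2
  exact ((((Metric.mdifferentiableAt_coordForm g (f p)).comp p hf).clm_apply hv).clm_apply
    hw).congr_of_eventuallyEq (inner_along_eventuallyEq g hf.continuousAt)

theorem differential_inner_along (g : Metric n M) (hV : DifferentiableAlong (m := m) f V p)
    (hW : DifferentiableAlong (m := m) f W p) (u : TangentSpace (𝓡 m) p) :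
    differential (fun x => g.inner (f x) (V x) (W x)) p u
      = g.inner (f p) (covDerivAlong g f V p u) (W p)
        + g.inner (f p) (V p) (covDerivAlong g f W p u) := by
  obtain ⟨hf, hv⟩ := differentiableAlong_iff.1 hV
  have hw := (differentiableAlong_iff.1 hW).2
  have hg := Metric.mdifferentiableAt_coordForm g (f p)
  have hchain : mvfderiv (𝓡 m) (coordForm g.inner (f p) ∘ f) p u
      = mvfderiv (𝓡 n) (coordForm g.inner (f p)) (f p) (push f p u) :=
    DFunLike.congr_fun (mfderiv_comp p hg hf) u
  rw [differential, (inner_along_eventuallyEq g hf.continuousAt).mfderiv_eq]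
  refine (mvfderiv_clm_apply₂ (hg.comp p hf) hv hw u).trans ?_
  rw [hchain, toCoord_self, toCoord_self, ← metricCoordDeriv_eq, metricCoordDeriv_eq_christoffel]
  refine (congr_arg₂ (_ + · + ·) (coordForm_self g.inner (f p) (coordDerivAlong f V p u) (W p))
    (coordForm_self g.inner (f p) (V p) (coordDerivAlong f W p u))).trans ?_
  simp only [covDerivAlong_eq, map_add, add_apply]
  ring

theorem covDerivAlong_coordField (g : Metric n M) (q : M) (u v : TangentSpace (𝓡 n) q) :
    covDerivAlong g id (coordField q v) q u = christoffel g q u v := by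
  have hconst (v : 𝔼 n) : mfderiv (𝓡 n) 𝓘(ℝ, 𝔼 n) (fun x => toCoord q x (ofCoord q x v)) q = 0 := by
    have hcoord : (fun x => toCoord q x (ofCoord q x v)) =ᶠ[𝓝 q] fun _ => v := by
      filter_upwards [eventually_mem_chart_source (n := n) continuousAt_id] with x hx
      exact toCoord_ofCoord hx v
    exact hcoord.mfderiv_eq.trans mfderiv_const
  have hderiv : coordDerivAlong id (coordField q v) q u = 0 := DFunLike.congr_fun (hconst v) u
  rw [covDerivAlong_eq, hderiv, zero_add, push, mfderiv_id, coordField_self]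
  rfl

theorem IsParallel.mvfderiv_coordEnd {g : Metric n M} {J : EndField n M} (hJ : IsParallel g J)
    (hsmooth : J.IsSmooth) (q : M) (u v : TangentSpace (𝓡 n) q) :
    mvfderiv (𝓡 n) (coordEnd J q) q u v
      = J q (christoffel g q u v) - christoffel g q u (J q v) := by
  have hderiv (v : 𝔼 n) : mvfderiv (𝓡 n) (fun x => coordEnd J q x v) q u
      = mvfderiv (𝓡 n) (coordEnd J q) q u v := by
    rw [mvfderiv_clm_apply (hsmooth.mdifferentiableAt_coordEnd q) mdifferentiableAt_const,
      mvfderiv_const, zero_apply, map_zero, add_zero]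
  have hparallel := hJ q u (coordField q v) (mdifferentiableAt_coordField q v)
  rw [covDerivAlong_coordField, covDerivAlong, push, mfderiv_id, coordField_self] at hparallel
  exact (hderiv v).symm.trans (eq_sub_of_add_eq hparallel)

theorem endField_along_eventuallyEq (J : EndField n M) (hf : ContinuousAt f p) :
    (fun x => toCoord (f p) (f x) (J (f x) (V x))) =ᶠ[𝓝 p] fun x =>
      coordEnd J (f p) (f x) (toCoord (f p) (f x) (V x)) := by
  filter_upwards [eventually_mem_chart_source (n := n) hf] with x hx
  exact (congr_arg (fun v => toCoord (f p) (f x) (J (f x) v)) (ofCoord_toCoord hx (V x))).symm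

theorem EndField.IsSmooth.differentiableAlong {J : EndField n M} (hJ : J.IsSmooth)
    (hV : DifferentiableAlong (m := m) f V p) :
    DifferentiableAlong (m := m) f (fun x => J (f x) (V x)) p := by
  obtain ⟨hf, hv⟩ := differentiableAlong_iff.1 hV
  exact differentiableAlong_iff.2 ⟨hf, (((hJ.mdifferentiableAt_coordEnd (f p)).comp p
    hf).clm_apply hv).congr_of_eventuallyEq (endField_along_eventuallyEq J hf.continuousAt)⟩

theorem covDerivAlong_endField {g : Metric n M} {J : EndField n M} (hJ : IsParallel g J)
    (hsmooth : J.IsSmooth) (hV : DifferentiableAlong (m := m) f V p) (u : TangentSpace (𝓡 m) p) :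
    covDerivAlong g f (fun x => J (f x) (V x)) p u = J (f p) (covDerivAlong g f V p u) := by
  obtain ⟨hf, hv⟩ := differentiableAlong_iff.1 hV
  have hcoordEnd := hsmooth.mdifferentiableAt_coordEnd (f p)
  have hchain : mvfderiv (𝓡 m) (coordEnd J (f p) ∘ f) p u
      = mvfderiv (𝓡 n) (coordEnd J (f p)) (f p) (push f p u) :=
    DFunLike.congr_fun (mfderiv_comp p hcoordEnd hf) u
  have hprod : coordDerivAlong f (fun x => J (f x) (V x)) p u
      = J (f p) (christoffel g (f p) (push f p u) (V p))
        - christoffel g (f p) (push f p u) (J (f p) (V p))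
        + J (f p) (coordDerivAlong f V p u) := by
    refine (DFunLike.congr_fun
      (endField_along_eventuallyEq J hf.continuousAt).mfderiv_eq u).trans ?_
    refine (mvfderiv_clm_apply (hcoordEnd.comp p hf) hv u).trans ?_
    rw [hchain, toCoord_self, hJ.mvfderiv_coordEnd hsmooth]
    exact congr_arg (fun w : TangentSpace (𝓡 n) (f p) => _ + w)
      (coordEnd_self J (f p) (coordDerivAlong f V p u))
  rw [covDerivAlong_eq, hprod, covDerivAlong_eq, map_add]
  abel

end AlongMap

section SecondDerivative

variable {m n : ℕ} {S : Type*} [TopologicalSpace S] [ChartedSpace (𝔼 m) S]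
  {M : Type*} [TopologicalSpace M] [ChartedSpace (𝔼 n) M] {f : S → M} {p : S}

theorem contDiffAt_writtenInExtChartAt (hf : ContMDiffAt (𝓡 m) (𝓡 n) 2 f p) :
    ContDiffAt ℝ 2 (writtenInExtChartAt (𝓡 m) (𝓡 n) p f) (extChartAt (𝓡 m) p p) := by
  have := (contMDiffAt_iff.1 hf).2
  rwa [ModelWithCorners.range_eq_univ, contDiffWithinAt_univ] at this

variable [IsManifold (𝓡 m) ∞ S] [IsManifold (𝓡 n) ∞ M]

/-- The second covariant derivative `∇̄_u f_* ∂_v` of `f` at `p`, where `∂_v` is the coordinate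
vector field with value `v` at `p`. -/
def covHessian (g : Metric n M) (f : S → M) (p : S) (u v : TangentSpace (𝓡 m) p) :
    TangentSpace (𝓡 n) (f p) :=
  covDerivAlong g f (fun x => push f x (coordField p v x)) p u

theorem differentiableAlong_push_coordField (hf : ContMDiffAt (𝓡 m) (𝓡 n) 2 f p)
    (v : TangentSpace (𝓡 m) p) :
    DifferentiableAlong (m := m) f (fun x => push (n := n) f x (coordField p v x)) p := by
  have : IsManifold (𝓡 m) 2 S := IsManifold.of_le (n := ∞) ENat.LEInfty.out
  have : IsManifold (𝓡 n) 2 M := IsManifold.of_le (n := ∞) ENat.LEInfty.out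
  have hpush := (hf.mfderiv_const (m := 1) (by norm_num)).mdifferentiableAt (by simp)
  have hconst (v : 𝔼 m) : MDifferentiableAt (𝓡 m) 𝓘(ℝ, 𝔼 n)
      (fun x => toCoord (f p) (f x) (push f x (ofCoord p x v))) p :=
    hpush.clm_apply (mdifferentiableAt_const (c := v))
  exact differentiableAlong_iff.2 ⟨hf.mdifferentiableAt (by simp), hconst v⟩

theorem toCoord_push {x : S} (hx : x ∈ (chartAt (𝔼 m) p).source)
    (hfx : f x ∈ (chartAt (𝔼 n) (f p)).source) (hf : MDifferentiableAt (𝓡 m) (𝓡 n) f x)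
    (v : TangentSpace (𝓡 m) x) : toCoord (f p) (f x) (push f x v)
      = fderiv ℝ (writtenInExtChartAt (𝓡 m) (𝓡 n) p f) (extChartAt (𝓡 m) p x)
          (toCoord p x v) := by
  have h1 : IsManifold (𝓡 m) 1 S := IsManifold.of_le (n := ∞) (by simp)
  have h2 : IsManifold (𝓡 n) 1 M := IsManifold.of_le (n := ∞) (by simp)
  set F := writtenInExtChartAt (𝓡 m) (𝓡 n) p f
  have hF : DifferentiableAt ℝ F (extChartAt (𝓡 m) p x) := by
    have := ((mdifferentiableAt_iff_of_mem_source hx hfx).1 hf).2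
    rw [ModelWithCorners.range_eq_univ] at this
    exact this.differentiableAt Filter.univ_mem
  have hcomp : F ∘ extChartAt (𝓡 m) p =ᶠ[𝓝 x] extChartAt (𝓡 n) (f p) ∘ f := by
    filter_upwards [(chartAt (𝔼 m) p).open_source.mem_nhds hx] with y hy
    simp [F, writtenInExtChartAt, hy]
  have hchart := mfderiv_comp x (mdifferentiableAt_extChartAt hfx) hf
  rw [← hcomp.mfderiv_eq, mfderiv_comp x hF.mdifferentiableAt (mdifferentiableAt_extChartAt hx),
    mfderiv_eq_fderiv] at hchart
  rw [toCoord, toCoord, TangentBundle.continuousLinearMapAt_trivializationAt hfx,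
    TangentBundle.continuousLinearMapAt_trivializationAt hx]
  exact (DFunLike.congr_fun hchart v).symm

theorem coordDerivAlong_push_coordField (hf : ContMDiffAt (𝓡 m) (𝓡 n) 2 f p)
    (u v : TangentSpace (𝓡 m) p) :
    coordDerivAlong f (fun x => push f x (coordField p v x)) p u
      = fderiv ℝ (fderiv ℝ (writtenInExtChartAt (𝓡 m) (𝓡 n) p f)) (extChartAt (𝓡 m) p p) u v := by
  have : IsManifold (𝓡 m) 2 S := IsManifold.of_le (n := ∞) ENat.LEInfty.out
  have : IsManifold (𝓡 n) 2 M := IsManifold.of_le (n := ∞) ENat.LEInfty.out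
  set F := writtenInExtChartAt (𝓡 m) (𝓡 n) p f
  have hcoord (v : 𝔼 m) : (fun x => toCoord (f p) (f x) (push f x (ofCoord p x v))) =ᶠ[𝓝 p]
      fun x => fderiv ℝ F (extChartAt (𝓡 m) p x) v := by
    filter_upwards [(chartAt (𝔼 m) p).open_source.mem_nhds (mem_chart_source _ p),
      eventually_mem_chart_source (n := n) hf.continuousAt,
      (contMDiffAt_iff_contMDiffAt_nhds (by simp)).1 hf] with x hx hfx hdiff
    rw [toCoord_push hx hfx (hdiff.mdifferentiableAt (by simp)), toCoord_ofCoord hx]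
  have hF : DifferentiableAt ℝ (fderiv ℝ F) (extChartAt (𝓡 m) p p) :=
    ((contDiffAt_writtenInExtChartAt hf).fderiv_right (m := 1) (by norm_num)).differentiableAt
      (by simp)
  have hchart : MDifferentiableAt (𝓡 m) 𝓘(ℝ, 𝔼 m) (extChartAt (𝓡 m) p) p :=
    mdifferentiableAt_extChartAt (mem_chart_source _ p)
  have hchain (v : 𝔼 m) :
      mvfderiv (𝓡 m) (fun x => fderiv ℝ F (extChartAt (𝓡 m) p x) v) p u
        = fderiv ℝ (fderiv ℝ F) (extChartAt (𝓡 m) p p) u v := by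
    have hcomp : mvfderiv (𝓡 m) (fderiv ℝ F ∘ extChartAt (𝓡 m) p) p u
        = fderiv ℝ (fderiv ℝ F) (extChartAt (𝓡 m) p p) u := by
      have := mfderiv_comp p hF.mdifferentiableAt hchart
      rw [mfderiv_extChartAt_self, mfderiv_eq_fderiv] at this
      exact DFunLike.congr_fun this u
    refine (mvfderiv_clm_apply (hF.mdifferentiableAt.comp p hchart) mdifferentiableAt_const
      u).trans ?_
    rw [hcomp, mvfderiv_const, zero_apply, map_zero, add_zero]
  exact (DFunLike.congr_fun (hcoord v).mfderiv_eq u).trans (hchain v)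

theorem covHessian_symm (g : Metric n M) (hf : ContMDiffAt (𝓡 m) (𝓡 n) 2 f p)
    (u v : TangentSpace (𝓡 m) p) : covHessian g f p u v = covHessian g f p v u := by
  have hsymm := (contDiffAt_writtenInExtChartAt hf).isSymmSndFDerivAt
    (by rw [minSmoothness_of_isRCLikeNormedField])
  rw [covHessian, covHessian, covDerivAlong_eq, covDerivAlong_eq,
    coordDerivAlong_push_coordField hf, coordDerivAlong_push_coordField hf, coordField_self,
    coordField_self, christoffel_comm]
  exact congr_arg (fun w : TangentSpace (𝓡 n) (f p) => w + _) (hsymm u v)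

end SecondDerivative

section Immersion

variable {m n : ℕ} {S : Type*} [TopologicalSpace S] [ChartedSpace (𝔼 m) S]
  {M : Type*} [TopologicalSpace M] [ChartedSpace (𝔼 n) M] [IsManifold (𝓡 n) ∞ M]
  (g : Metric n M) {f : S → M} {p : S}

/-- The value at `p` of the induced metric, as a bilinear form. -/
abbrev inducedForm (g : Metric n M) (f : S → M) (p : S) :
    LinearMap.BilinForm ℝ (TangentSpace (𝓡 m) p) :=
  (g.inner (f p)).toLinearMap₁₂.compl₁₂ (push f p).toLinearMap (push f p).toLinearMap

theorem eq_zero_of_inducedForm_eq_zero (hf : Function.Injective (push (m := m) (n := n) f p))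
    (z : TangentSpace (𝓡 m) p) (hz : ∀ v, inducedForm g f p z v = 0) : z = 0 := by
  by_contra h
  exact (g.pos (f p) _ ((map_ne_zero_iff _ hf).2 h)).ne' (hz z)

theorem inner_push_dualVector (hf : Function.Injective (push (m := m) (n := n) f p))
    (ℓ : TangentSpace (𝓡 m) p →ₗ[ℝ] ℝ) (v : TangentSpace (𝓡 m) p) :
    g.inner (f p) (push f p (dualVector (fun z w => inducedMetric g f p z w) ℓ)) (push f p v)
      = ℓ v :=
  have : FiniteDimensional ℝ (TangentSpace (𝓡 m) p) := inferInstanceAs (FiniteDimensional ℝ (𝔼 m))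
  dualVector_spec (inducedForm g f p) (eq_zero_of_inducedForm_eq_zero g hf) ℓ v

theorem inner_push_gradient (hf : Function.Injective (push (m := m) (n := n) f p)) (φ : S → ℝ)
    (v : TangentSpace (𝓡 m) p) :
    g.inner (f p) (push f p (gradient (m := m) g f φ p)) (push f p v) = differential φ p v :=
  inner_push_dualVector g hf (mvfderiv (𝓡 m) φ p).toLinearMap v

theorem inner_normalPart_push (hf : Function.Injective (push (m := m) (n := n) f p))
    (w : TangentSpace (𝓡 n) (f p)) (v : TangentSpace (𝓡 m) p) :
    g.inner (f p) (normalPart (m := m) g f p w) (push f p v) = 0 := by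
  rw [normalPart, map_sub, sub_apply, sub_eq_zero]
  exact (inner_push_dualVector g hf ((g.inner (f p) w).comp (push f p)).toLinearMap v).symm

variable {g} in
theorem inner_normalPart {ν : TangentSpace (𝓡 n) (f p)}
    (hν : ∀ v : TangentSpace (𝓡 m) p, g.inner (f p) (push f p v) ν = 0)
    (w : TangentSpace (𝓡 n) (f p)) :
    g.inner (f p) (normalPart (m := m) g f p w) ν = g.inner (f p) w ν := by
  rw [normalPart, map_sub, sub_apply, hν, sub_zero]

theorem eq_of_inner_push_eq_of_inner_normal_eq {v w : TangentSpace (𝓡 n) (f p)}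
    (htangent : ∀ u : TangentSpace (𝓡 m) p,
      g.inner (f p) v (push f p u) = g.inner (f p) w (push f p u))
    (hnormal : ∀ ν, (∀ u : TangentSpace (𝓡 m) p, g.inner (f p) (push f p u) ν = 0) →
      g.inner (f p) v ν = g.inner (f p) w ν) : v = w := by
  have hsub (ν : TangentSpace (𝓡 n) (f p)) :
      g.inner (f p) (v - w) ν = g.inner (f p) v ν - g.inner (f p) w ν := by
    rw [map_sub, sub_apply]
  have hperp (u : TangentSpace (𝓡 m) p) : g.inner (f p) (push f p u) (v - w) = 0 := by
    rw [g.symm, hsub, htangent, sub_self]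
  by_contra hne
  exact (g.pos (f p) _ (sub_ne_zero.2 hne)).ne'
    ((hsub _).trans (sub_eq_zero.2 (hnormal _ hperp)))

variable [IsManifold (𝓡 m) ∞ S]

theorem inner_meanCurvature_push (hf : Function.Injective (push (m := m) (n := n) f p))
    (v : TangentSpace (𝓡 m) p) : g.inner (f p) (meanCurvature (m := m) g f p) (push f p v) = 0 := by
  simp only [meanCurvature, secondFundamentalForm, map_sum, map_smul, sum_apply, smul_apply,
    inner_normalPart_push g hf, smul_zero, Finset.sum_const_zero]

variable {g} in
theorem inner_meanCurvature {ν : TangentSpace (𝓡 n) (f p)}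
    (hν : ∀ v : TangentSpace (𝓡 m) p, g.inner (f p) (push f p v) ν = 0) :
    g.inner (f p) (meanCurvature (m := m) g f p) ν = ∑ i, ∑ j,
      (Matrix.of fun k l => inducedMetric g f p (coordVec (n := m) p k) (coordVec p l))⁻¹ i j *
        g.inner (f p) (covHessian g f p (coordVec p i) (coordVec p j)) ν := by
  simp only [meanCurvature, secondFundamentalForm, map_sum, map_smul, sum_apply, smul_apply,
    inner_normalPart hν, smul_eq_mul, covHessian]

end Immersion

section SurfaceLinearAlgebra

variable {V : Type*} [AddCommGroup V] [Module ℝ V]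

theorem isAlt_apply_eq {B : LinearMap.BilinForm ℝ V} (hB : B.IsAlt)
    (b : Module.Basis (Fin 2) ℝ V) (u v : V) :
    B u v = (b.repr u 0 * b.repr v 1 - b.repr u 1 * b.repr v 0) * B (b 0) (b 1) := by
  conv_lhs => rw [← b.sum_repr u, ← b.sum_repr v]
  simp only [Fin.sum_univ_two, map_add, map_smul, LinearMap.add_apply, LinearMap.smul_apply,
    smul_eq_mul, hB.self_eq_zero, ← hB.neg_eq (b 0) (b 1)]
  ring

theorem isAlt_mul_comm {A B : LinearMap.BilinForm ℝ V} (hA : A.IsAlt) (hB : B.IsAlt)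
    (b : Module.Basis (Fin 2) ℝ V) (u v : V) :
    A u v * B (b 0) (b 1) = A (b 0) (b 1) * B u v := by
  rw [isAlt_apply_eq hA b, isAlt_apply_eq hB b u]
  ring

theorem isAlt_smul_eq {B : LinearMap.BilinForm ℝ V} (hB : B.IsAlt)
    (b : Module.Basis (Fin 2) ℝ V) (w : V) :
    B (b 0) (b 1) • w = B w (b 1) • b 0 - B w (b 0) • b 1 := by
  rw [isAlt_apply_eq hB b w, isAlt_apply_eq hB b w]
  conv_lhs => rw [← b.sum_repr w, Fin.sum_univ_two]
  simp only [b.repr_self, Finsupp.single_eq_same, Finsupp.single_eq_of_ne zero_ne_one,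
    Finsupp.single_eq_of_ne one_ne_zero]
  module

namespace IsHyperhermitian

variable {G : LinearMap.BilinForm ℝ V} {J : Fin 3 → V →ₗ[ℝ] V}

theorem sum_kahler_sq (h : IsHyperhermitian G J) (hV : Module.finrank ℝ V = 4) (x y : V) :
    ∑ a, G (J a x) y ^ 2 = G x x * G y y - G x y ^ 2 := by
  simpa only [pow_two] using h.sum_kahler_mul hV x y y

theorem kahler_swap (h : IsHyperhermitian G J) (a : Fin 3) (x y : V) :
    G (J a x) y = -G (J a y) x := by
  rw [h.skew, h.symm]

theorem sum_kahler_mul_of_orthogonal (h : IsHyperhermitian G J) (hV : Module.finrank ℝ V = 4)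
    {e₀ e₁ ν : V} (h₀ : G e₀ ν = 0) (h₁ : G e₁ ν = 0) (D₀₀ D₀₁ D₁₁ : V) :
    ∑ a, ((G (J a D₀₁) e₁ + G (J a e₀) D₁₁) * G (J a e₀) ν
        - (G (J a D₀₀) e₁ + G (J a e₀) D₀₁) * G (J a e₁) ν)
      = G e₀ e₀ * G D₁₁ ν - 2 * G e₀ e₁ * G D₀₁ ν + G e₁ e₁ * G D₀₀ ν := by
  have h00 := h.sum_kahler_mul hV e₀ D₁₁ ν
  have h01 := h.sum_kahler_mul_polarized hV e₀ e₁ D₀₁ ν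
  have h11 := h.sum_kahler_mul hV e₁ D₀₀ ν
  simp only [Fin.sum_univ_three, h.kahler_swap _ _ e₁, h₀, h₁] at *
  linear_combination h00 - h01 + h11

end IsHyperhermitian

end SurfaceLinearAlgebra

theorem sqrt_sum_sq_mul_differential {ι : Type*} [Fintype ι] {m : ℕ} {S : Type*}
    [TopologicalSpace S] [ChartedSpace (𝔼 m) S] {N : ι → S → ℝ} {p : S}
    (hN : ∀ a, MDifferentiableAt (𝓡 m) 𝓘(ℝ, ℝ) (N a) p) (hpos : 0 < ∑ a, N a p ^ 2)
    (v : TangentSpace (𝓡 m) p) :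
    √(∑ a, N a p ^ 2) * differential (fun x => √(∑ a, N a x ^ 2)) p v
      = ∑ a, N a p * differential (N a) p v := by
  let dsq (a : ι) : (ι → ℝ) →L[ℝ] ℝ := (2 * N a p) • ContinuousLinearMap.proj a
  have hsq (a : ι) : HasFDerivAt (fun y : ι → ℝ => y a ^ 2) (dsq a) fun a => N a p := by
    simpa [dsq] using (hasFDerivAt_apply (𝕜 := ℝ) a fun a => N a p).pow 2
  have hnorm : HasFDerivAt (fun y : ι → ℝ => √(∑ a, y a ^ 2)) _ fun a => N a p :=
    (HasFDerivAt.fun_sum fun a _ => hsq a).sqrt hpos.ne'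
  have htuple : HasMFDerivAt (𝓡 m) 𝓘(ℝ, ι → ℝ) (fun x a => N a x) p
      (ContinuousLinearMap.pi fun a => mvfderiv (𝓡 m) (N a) p) :=
    ⟨continuousAt_pi.2 fun a => (hN a).continuousAt,
      hasFDerivWithinAt_pi.2 fun a => (hN a).hasMFDerivAt.2⟩
  have hcomp := hnorm.hasMFDerivAt.comp p htuple
  have hchain : differential (fun x => √(∑ a, N a x ^ 2)) p v
      = ((1 / (2 * √(∑ a, N a p ^ 2))) • ∑ a, dsq a) fun a => differential (N a) p v :=
    DFunLike.congr_fun hcomp.mfderiv v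
  have hsqrt := (Real.sqrt_pos.2 hpos).ne'
  simp only [hchain, dsq, smul_apply, sum_apply, ContinuousLinearMap.proj_apply, smul_eq_mul,
    mul_assoc, ← Finset.mul_sum]
  field_simp

section KahlerForm

variable {m n : ℕ} {S : Type*} [TopologicalSpace S] [ChartedSpace (𝔼 m) S]
  [IsManifold (𝓡 m) ∞ S] {M : Type*} [TopologicalSpace M] [ChartedSpace (𝔼 n) M]
  [IsManifold (𝓡 n) ∞ M] {g : Metric n M} {J : EndField n M} {f : S → M} {p : S}

theorem BilinField.IsSmooth.mdifferentiableAt_coordField {b : BilinField m S} (hb : b.IsSmooth)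
    (u v : TangentSpace (𝓡 m) p) :
    MDifferentiableAt (𝓡 m) 𝓘(ℝ, ℝ) (fun x => b x (coordField p u x) (coordField p v x)) p := by
  have hconst (u v : 𝔼 m) :
      MDifferentiableAt (𝓡 m) 𝓘(ℝ, ℝ) (fun x => coordForm b p x u v) p :=
    ((hb.mdifferentiableAt_coordForm p).clm_apply (mdifferentiableAt_const (c := u))).clm_apply
      (mdifferentiableAt_const (c := v))
  exact hconst u v

theorem IsKahler.kahlerForm_self (hJ : IsKahler g J) (q : M) (v : TangentSpace (𝓡 n) q) :
    kahlerForm g J q v v = 0 := by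
  have h : g.inner q (J q v) v = -g.inner q (J q v) v := by
    conv_lhs => rw [← hJ.orthogonal, hJ.sq, map_neg, neg_apply, g.symm]
  change g.inner q (J q v) v = 0
  linarith

theorem IsKahler.mdifferentiableAt_pullback_coordField (hJ : IsKahler g J)
    (hf : ContMDiffAt (𝓡 m) (𝓡 n) 2 f p) (u v : TangentSpace (𝓡 m) p) :
    MDifferentiableAt (𝓡 m) 𝓘(ℝ, ℝ)
      (fun x => pullback f (kahlerForm g J) x (coordField p u x) (coordField p v x)) p :=
  mdifferentiableAt_inner_along g
    (hJ.smooth.differentiableAlong (differentiableAlong_push_coordField hf u))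
    (differentiableAlong_push_coordField hf v)

theorem IsKahler.differential_pullback_coordField (hJ : IsKahler g J)
    (hf : ContMDiffAt (𝓡 m) (𝓡 n) 2 f p) (u v w : TangentSpace (𝓡 m) p) :
    differential (fun x => pullback f (kahlerForm g J) x (coordField p u x) (coordField p v x)) p w
      = kahlerForm g J (f p) (covHessian g f p w u) (push f p v)
        + kahlerForm g J (f p) (push f p u) (covHessian g f p w v) := by
  have hu := differentiableAlong_push_coordField hf u
  refine (differential_inner_along g (hJ.smooth.differentiableAlong hu)
    (differentiableAlong_push_coordField hf v) w).trans ?_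
  rw [covDerivAlong_endField hJ.parallel hJ.smooth hu, coordField_self, coordField_self]
  rfl

end KahlerForm

section Surface

variable {S : Type*} [TopologicalSpace S] [ChartedSpace (𝔼 2) S]

/-- The basis `∂₀, ∂₁` of coordinate vectors at `p`. -/
def coordBasis (p : S) : Module.Basis (Fin 2) ℝ (TangentSpace (𝓡 2) p) :=
  (EuclideanSpace.basisFun (Fin 2) ℝ).toBasis

theorem coordBasis_apply (p : S) (i : Fin 2) : coordBasis p i = ∂ₛ p i :=
  (congr_fun (EuclideanSpace.basisFun (Fin 2) ℝ).coe_toBasis i).trans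
    (EuclideanSpace.basisFun_apply (Fin 2) ℝ i)

variable [IsManifold (𝓡 2) ∞ S]

namespace VolumeForm

variable (ρ : VolumeForm S) (p : S)

/-- The coefficient `ρ(∂₀, ∂₁)` of the volume form at `p`. -/
abbrev density : ℝ :=
  ρ.form p (∂ₛ p 0) (∂ₛ p 1)

theorem isAlt : (ρ.form p).toLinearMap₁₂.IsAlt :=
  ρ.alternating p

theorem density_ne_zero : ρ.density p ≠ 0 := by
  intro h
  refine ρ.ne_zero p (ContinuousLinearMap.ext fun u => ContinuousLinearMap.ext fun v => ?_)
  refine (isAlt_apply_eq (ρ.isAlt p) (coordBasis p) u v).trans ?_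
  rw [coordBasis_apply, coordBasis_apply]
  exact mul_eq_zero_of_right _ h

theorem density_smul (w : TangentSpace (𝓡 2) p) :
    ρ.density p • w = ρ.form p w (∂ₛ p 1) • ∂ₛ p 0
      - ρ.form p w (∂ₛ p 0) • ∂ₛ p 1 := by
  have := isAlt_smul_eq (ρ.isAlt p) (coordBasis p) w
  rwa [coordBasis_apply, coordBasis_apply] at this

variable {p} in
theorem eq_zero_of_form_eq_zero {w : TangentSpace (𝓡 2) p} (hw : ∀ v, ρ.form p w v = 0) :
    w = 0 := by
  have := ρ.density_smul p w
  rw [hw, hw, zero_smul, zero_smul, sub_zero] at this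
  exact (smul_eq_zero.1 this).resolve_left (ρ.density_ne_zero p)

theorem form_hamiltonianField (N : S → ℝ) (v : TangentSpace (𝓡 2) p) :
    ρ.form p (hamiltonianField ρ N p) v = differential N p v :=
  have : FiniteDimensional ℝ (TangentSpace (𝓡 2) p) := inferInstanceAs (FiniteDimensional ℝ (𝔼 2))
  dualVector_spec (ρ.form p).toLinearMap₁₂ (fun _ => ρ.eq_zero_of_form_eq_zero)
    (mvfderiv (𝓡 2) N p).toLinearMap v

theorem density_smul_hamiltonianField (N : S → ℝ) :
    ρ.density p • hamiltonianField ρ N p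
      = differential N p (∂ₛ p 1) • ∂ₛ p 0
        - differential N p (∂ₛ p 0) • ∂ₛ p 1 := by
  rw [density_smul, form_hamiltonianField, form_hamiltonianField]

/-- The coefficient `ρ(∂₀, ∂₁)` at `x` of the volume form in the preferred chart at `p`, where
`density` takes the preferred chart at `x` itself. -/
def localDensity (p x : S) : ℝ :=
  ρ.form x (coordField p (∂ₛ p 0) x) (coordField p (∂ₛ p 1) x)

theorem mdifferentiableAt_localDensity :
    MDifferentiableAt (𝓡 2) 𝓘(ℝ, ℝ) (ρ.localDensity p) p :=
  BilinField.IsSmooth.mdifferentiableAt_coordField ρ.smooth _ _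

theorem localDensity_self : ρ.localDensity p p = ρ.density p := by
  rw [localDensity, coordField_self, coordField_self]

end VolumeForm

end Surface

section KahlerRatio

variable {S : Type*} [TopologicalSpace S] [ChartedSpace (𝔼 2) S] [IsManifold (𝓡 2) ∞ S]
  {M : Type*} [TopologicalSpace M] [ChartedSpace (𝔼 4) M] [IsManifold (𝓡 4) ∞ M]
  (ρ : VolumeForm S) {g : Metric 4 M} {J : EndField 4 M} {f : S → M} {p : S}

theorem IsKahler.pullback_kahlerForm (hJ : IsKahler g J) (u v : TangentSpace (𝓡 2) p) :
    pullback f (kahlerForm g J) p u v = kahlerRatio ρ g J f p * ρ.form p u v := by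
  let B : LinearMap.BilinForm ℝ (TangentSpace (𝓡 2) p) :=
    (kahlerForm g J (f p)).toLinearMap₁₂.compl₁₂ (push f p).toLinearMap (push f p).toLinearMap
  have hB : B.IsAlt := fun v => hJ.kahlerForm_self (f p) (push f p v)
  have := isAlt_mul_comm hB (ρ.isAlt p) (coordBasis p) u v
  rw [coordBasis_apply, coordBasis_apply] at this
  rw [kahlerRatio, div_mul_eq_mul_div]
  exact eq_div_of_mul_eq (ρ.density_ne_zero p) this

theorem IsKahler.mdifferentiableAt_kahlerRatio (hJ : IsKahler g J)
    (hf : ContMDiffAt (𝓡 2) (𝓡 4) 2 f p) :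
    MDifferentiableAt (𝓡 2) 𝓘(ℝ, ℝ) (kahlerRatio ρ g J f) p := by
  have hne : ρ.localDensity p p ≠ 0 := (ρ.localDensity_self p).trans_ne (ρ.density_ne_zero p)
  have hρ := ρ.mdifferentiableAt_localDensity p
  refine ((hJ.mdifferentiableAt_pullback_coordField hf (∂ₛ p 0) (∂ₛ p 1)).div
    hρ hne).congr_of_eventuallyEq ?_
  filter_upwards [hρ.continuousAt.eventually_ne hne] with x hx
  exact eq_div_of_mul_eq hx (hJ.pullback_kahlerForm ρ _ _).symm

theorem IsKahler.density_mul_differential_kahlerRatio (hJ : IsKahler g J)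
    (hf : ContMDiffAt (𝓡 2) (𝓡 4) 2 f p) (w : TangentSpace (𝓡 2) p) :
    ρ.density p * differential (kahlerRatio ρ g J f) p w
      = kahlerForm g J (f p) (covHessian g f p w (∂ₛ p 0)) (push f p (∂ₛ p 1))
        + kahlerForm g J (f p) (push f p (∂ₛ p 0)) (covHessian g f p w (∂ₛ p 1))
        - kahlerRatio ρ g J f p * differential (ρ.localDensity p) p w := by
  have hmul : (fun x => pullback f (kahlerForm g J) x (coordField p (∂ₛ p 0) x)
      (coordField p (∂ₛ p 1) x)) = fun x => kahlerRatio ρ g J f x * ρ.localDensity p x :=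
    funext fun x => hJ.pullback_kahlerForm ρ _ _
  have hleibniz : differential (fun x => kahlerRatio ρ g J f x * ρ.localDensity p x) p w
      = kahlerRatio ρ g J f p * differential (ρ.localDensity p) p w
        + ρ.localDensity p p * differential (kahlerRatio ρ g J f) p w :=
    DFunLike.congr_fun (mvfderiv_fun_mul (hJ.mdifferentiableAt_kahlerRatio ρ hf)
      (ρ.mdifferentiableAt_localDensity p)) w
  rw [← hmul, hJ.differential_pullback_coordField hf, ρ.localDensity_self] at hleibniz
  rw [hleibniz]
  ring

end KahlerRatio

section Gram

variable {n : ℕ} {S : Type*} [TopologicalSpace S] [ChartedSpace (𝔼 2) S]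
  {M : Type*} [TopologicalSpace M] [ChartedSpace (𝔼 n) M] [IsManifold (𝓡 n) ∞ M]
  {g : Metric n M} {f : S → M} {p : S}

/-- The Gram determinant of the induced metric in the coordinates at `p`. -/
def gramDet (g : Metric n M) (f : S → M) (p : S) : ℝ :=
  inducedMetric g f p (∂ₛ p 0) (∂ₛ p 0) * inducedMetric g f p (∂ₛ p 1) (∂ₛ p 1)
    - inducedMetric g f p (∂ₛ p 0) (∂ₛ p 1) ^ 2

theorem gramDet_pos (hinj : Function.Injective (push (m := 2) (n := n) f p)) :
    0 < gramDet g f p := by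
  have hpos (v : TangentSpace (𝓡 2) p) (hv : v ≠ 0) : 0 < inducedForm g f p v v :=
    g.pos (f p) _ ((map_ne_zero_iff _ hinj).2 hv)
  have hsymm : LinearMap.IsSymm (inducedForm (m := 2) g f p) := ⟨fun _ _ => g.symm (f p) _ _⟩
  have hli : LinearIndependent ℝ ![∂ₛ p 0, ∂ₛ p 1] := by
    convert (coordBasis p).linearIndependent using 1
    ext i : 1
    fin_cases i <;> exact (coordBasis_apply p _).symm
  exact sub_pos.2 ((LinearMap.BilinForm.apply_sq_lt_iff_linearIndependent_of_symm _ hpos hsymm _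
    _).2 hli)

variable [IsManifold (𝓡 2) ∞ S]

/-- The vector `(det g) g^{ij} ∇̄_i f_* ∂_j`, for `g` the induced metric and `∂₀`, `∂₁` the
coordinates at `p`: the contraction of `covHessian` with the adjugate of the Gram matrix. -/
def adjugateHessian (g : Metric n M) (f : S → M) (p : S) : TangentSpace (𝓡 n) (f p) :=
  inducedMetric g f p (∂ₛ p 0) (∂ₛ p 0) • covHessian g f p (∂ₛ p 1) (∂ₛ p 1)
    - (2 * inducedMetric g f p (∂ₛ p 0) (∂ₛ p 1)) • covHessian g f p (∂ₛ p 0) (∂ₛ p 1)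
    + inducedMetric g f p (∂ₛ p 1) (∂ₛ p 1) • covHessian g f p (∂ₛ p 0) (∂ₛ p 0)

theorem inner_adjugateHessian (ν : TangentSpace (𝓡 n) (f p)) :
    g.inner (f p) (adjugateHessian g f p) ν
      = inducedMetric g f p (∂ₛ p 0) (∂ₛ p 0) * g.inner (f p) (covHessian g f p (∂ₛ p 1) (∂ₛ p 1)) ν
        - 2 * inducedMetric g f p (∂ₛ p 0) (∂ₛ p 1)
          * g.inner (f p) (covHessian g f p (∂ₛ p 0) (∂ₛ p 1)) ν
        + inducedMetric g f p (∂ₛ p 1) (∂ₛ p 1)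
          * g.inner (f p) (covHessian g f p (∂ₛ p 0) (∂ₛ p 0)) ν := by
  simp only [adjugateHessian, map_add, map_sub, map_smul, add_apply, sub_apply, smul_apply,
    smul_eq_mul]

theorem gramDet_mul_inner_meanCurvature (hf : ContMDiffAt (𝓡 2) (𝓡 n) 2 f p)
    (hinj : Function.Injective (push (m := 2) (n := n) f p)) {ν : TangentSpace (𝓡 n) (f p)}
    (hν : ∀ v : TangentSpace (𝓡 2) p, g.inner (f p) (push f p v) ν = 0) :
    gramDet g f p * g.inner (f p) (meanCurvature (m := 2) g f p) ν
      = g.inner (f p) (adjugateHessian g f p) ν := by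
  have hcomm : inducedMetric g f p (∂ₛ p 1) (∂ₛ p 0) = inducedMetric g f p (∂ₛ p 0) (∂ₛ p 1) :=
    g.symm _ _ _
  have hdet : (Matrix.of fun k l => inducedMetric g f p (∂ₛ p k) (∂ₛ p l)).det = gramDet g f p := by
    rw [Matrix.det_fin_two]
    simp only [Matrix.of_apply, hcomm, gramDet, pow_two]
  have hne := (gramDet_pos (g := g) hinj).ne'
  rw [inner_adjugateHessian, inner_meanCurvature hν, Matrix.inv_def, hdet, Ring.inverse_eq_inv',
    Matrix.adjugate_fin_two]
  simp only [Fin.sum_univ_two, Matrix.smul_apply, Matrix.of_apply, Matrix.cons_val',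
    Matrix.cons_val_zero, Matrix.cons_val_one, hcomm, covHessian_symm g hf (∂ₛ p 1) (∂ₛ p 0),
    smul_eq_mul, Matrix.cons_val_fin_one]
  field_simp
  ring

end Gram

section Hyperkahler

variable {M : Type*} [TopologicalSpace M] [ChartedSpace (𝔼 4) M] [IsManifold (𝓡 4) ∞ M]
  (h : HyperkahlerStructure M)

namespace HyperkahlerStructure

/-- The complex structures `I`, `J`, `K`, indexed for summation. -/
def complexStructure : Fin 3 → EndField 4 M :=
  ![h.I, h.J, h.K]

/-- The Kähler forms `ω̄₁`, `ω̄₂`, `ω̄₃`. -/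
abbrev form (a : Fin 3) : BilinField 4 M :=
  kahlerForm h.metric (h.complexStructure a)

/-- The functions `N₁`, `N₂`, `N₃`. -/
abbrev ratio {S : Type*} [TopologicalSpace S] [ChartedSpace (𝔼 2) S] [IsManifold (𝓡 2) ∞ S]
    (ρ : VolumeForm S) (f : S → M) (a : Fin 3) : S → ℝ :=
  kahlerRatio ρ h.metric (h.complexStructure a) f

theorem isKahler (a : Fin 3) : IsKahler h.metric (h.complexStructure a) := by
  fin_cases a
  exacts [h.kahler_I, h.kahler_J, h.kahler_K]

theorem isHyperhermitian (q : M) :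
    IsHyperhermitian (h.metric.inner q).toLinearMap₁₂
      fun a => (h.complexStructure a q).toLinearMap where
  symm := h.metric.symm q
  pos := h.metric.pos q
  sq a := (h.isKahler a).sq q
  orthogonal a := (h.isKahler a).orthogonal q
  mul_eq := h.mul_eq q

end HyperkahlerStructure

theorem finrank_tangentSpace {n : ℕ} {X : Type*} [TopologicalSpace X] [ChartedSpace (𝔼 n) X]
    (q : X) : Module.finrank ℝ (TangentSpace (𝓡 n) q) = n :=
  finrank_euclideanSpace_fin

variable {S : Type*} [TopologicalSpace S] [ChartedSpace (𝔼 2) S] [IsManifold (𝓡 2) ∞ S]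
  (ρ : VolumeForm S) {f : S → M} {p : S}

theorem inner_hFlowVelocity (ν : TangentSpace (𝓡 4) (f p)) :
    h.metric.inner (f p) (hFlowVelocity ρ h f p) ν
      = ∑ a, h.form a (f p) (push f p (hamiltonianField ρ (h.ratio ρ f a) p)) ν := by
  rw [hFlowVelocity, map_add, map_add, add_apply, add_apply, Fin.sum_univ_three]
  rfl

theorem sum_ratio_sq :
    ∑ a, h.ratio ρ f a p ^ 2 = gramDet h.metric f p / ρ.density p ^ 2 := by
  have := (h.isHyperhermitian (f p)).sum_kahler_sq (finrank_tangentSpace (f p))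
    (push f p (∂ₛ p 0)) (push f p (∂ₛ p 1))
  simp only [kahlerRatio, div_pow, ← Finset.sum_div]
  exact congr_arg (· / _) this

theorem areaRatio_eq_sqrt :
    areaRatio ρ h.metric f p = √(∑ a, h.ratio ρ f a p ^ 2) := by
  rw [sum_ratio_sq, Real.sqrt_div' _ (sq_nonneg _), Real.sqrt_sq_eq_abs]
  have hρ := ρ.density_ne_zero p
  have hsign : (SignType.sign (ρ.density p) : ℝ) / ρ.density p = 1 / |ρ.density p| := by
    rw [div_eq_div_iff hρ (abs_ne_zero.2 hρ), sign_mul_abs, one_mul]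
  calc areaRatio ρ h.metric f p
      = SignType.sign (ρ.density p) / ρ.density p * √(gramDet h.metric f p) := mul_div_right_comm ..
    _ = √(gramDet h.metric f p) / |ρ.density p| := by rw [hsign, one_div_mul_eq_div]

theorem areaRatio_mul_differential (hf : ContMDiffAt (𝓡 2) (𝓡 4) 2 f p)
    (hinj : Function.Injective (push (m := 2) (n := 4) f p)) (v : TangentSpace (𝓡 2) p) :
    areaRatio ρ h.metric f p * differential (areaRatio ρ h.metric f) p v
      = ∑ a, h.ratio ρ f a p * differential (h.ratio ρ f a) p v := by
  have hpos : 0 < ∑ a, h.ratio ρ f a p ^ 2 := by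
    rw [sum_ratio_sq]
    exact div_pos (gramDet_pos hinj) (sq_pos_of_ne_zero (ρ.density_ne_zero p))
  have hsqrt : areaRatio ρ h.metric f = fun x => √(∑ a, h.ratio ρ f a x ^ 2) :=
    funext fun _ => areaRatio_eq_sqrt h ρ
  rw [hsqrt]
  exact sqrt_sum_sq_mul_differential
    (fun a => (h.isKahler a).mdifferentiableAt_kahlerRatio ρ hf) hpos v

theorem inner_hFlowVelocity_push (v : TangentSpace (𝓡 2) p) :
    h.metric.inner (f p) (hFlowVelocity ρ h f p) (push f p v)
      = ∑ a, h.ratio ρ f a p * differential (h.ratio ρ f a) p v := by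
  refine (inner_hFlowVelocity h ρ _).trans (Finset.sum_congr rfl fun a _ => ?_)
  rw [← ρ.form_hamiltonianField, ← (h.isKahler a).pullback_kahlerForm ρ]
  rfl

theorem sum_ratio_mul_form_eq_zero {ν : TangentSpace (𝓡 4) (f p)}
    (hν : ∀ v : TangentSpace (𝓡 2) p, h.metric.inner (f p) (push f p v) ν = 0) (i : Fin 2) :
    ∑ a, h.ratio ρ f a p * h.form a (f p) (push f p (∂ₛ p i)) ν = 0 := by
  have hsum := (h.isHyperhermitian (f p)).sum_kahler_mul (finrank_tangentSpace (f p))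
  have hcancel (a : Fin 3) : h.ratio ρ f a p * ρ.density p
      = h.form a (f p) (push f p (∂ₛ p 0)) (push f p (∂ₛ p 1)) :=
    div_mul_cancel₀ _ (ρ.density_ne_zero p)
  refine (mul_eq_zero.1 ?_).resolve_right (ρ.density_ne_zero p)
  simp only [Finset.sum_mul, mul_right_comm _ _ (ρ.density p), hcancel]
  fin_cases i
  · refine (hsum (push f p (∂ₛ p 0)) (push f p (∂ₛ p 1)) ν).trans ?_
    simp [hν]
  · refine (Finset.sum_congr rfl fun a _ => congr_arg (· * _)
      ((h.isHyperhermitian (f p)).kahler_swap a _ _)).trans ?_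
    have := hsum (push f p (∂ₛ p 1)) (push f p (∂ₛ p 0)) ν
    simp only [neg_mul, Finset.sum_neg_distrib, neg_eq_zero]
    exact this.trans (by simp [hν])

theorem inner_adjugateHessian_eq_sum {ν : TangentSpace (𝓡 4) (f p)}
    (hν : ∀ v : TangentSpace (𝓡 2) p, h.metric.inner (f p) (push f p v) ν = 0) :
    h.metric.inner (f p) (adjugateHessian h.metric f p) ν
      = ∑ a, ((h.form a (f p) (covHessian h.metric f p (∂ₛ p 0) (∂ₛ p 1)) (push f p (∂ₛ p 1))
            + h.form a (f p) (push f p (∂ₛ p 0)) (covHessian h.metric f p (∂ₛ p 1) (∂ₛ p 1)))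
          * h.form a (f p) (push f p (∂ₛ p 0)) ν
        - (h.form a (f p) (covHessian h.metric f p (∂ₛ p 0) (∂ₛ p 0)) (push f p (∂ₛ p 1))
            + h.form a (f p) (push f p (∂ₛ p 0)) (covHessian h.metric f p (∂ₛ p 0) (∂ₛ p 1)))
          * h.form a (f p) (push f p (∂ₛ p 1)) ν) :=
  (inner_adjugateHessian ν).trans ((h.isHyperhermitian (f p)).sum_kahler_mul_of_orthogonal
    (finrank_tangentSpace (f p)) (hν (∂ₛ p 0)) (hν (∂ₛ p 1)) _ _ _).symm

theorem density_sq_mul_inner_hFlowVelocity (hf : ContMDiffAt (𝓡 2) (𝓡 4) 2 f p)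
    {ν : TangentSpace (𝓡 4) (f p)}
    (hν : ∀ v : TangentSpace (𝓡 2) p, h.metric.inner (f p) (push f p v) ν = 0) :
    ρ.density p ^ 2 * h.metric.inner (f p) (hFlowVelocity ρ h f p) ν
      = h.metric.inner (f p) (adjugateHessian h.metric f p) ν := by
  have hdN (a : Fin 3) := (h.isKahler a).density_mul_differential_kahlerRatio ρ hf
  have hinner (a : Fin 3) :
      ρ.density p * h.form a (f p) (push f p (hamiltonianField ρ (h.ratio ρ f a) p)) ν
        = differential (h.ratio ρ f a) p (∂ₛ p 1) * h.form a (f p) (push f p (∂ₛ p 0)) ν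
          - differential (h.ratio ρ f a) p (∂ₛ p 0) * h.form a (f p) (push f p (∂ₛ p 1)) ν := by
    have := congr_arg (fun w => h.form a (f p) (push f p w) ν)
      (ρ.density_smul_hamiltonianField p (h.ratio ρ f a))
    simpa only [map_sub, map_smul, sub_apply, smul_apply, smul_eq_mul] using this
  have h0 := sum_ratio_mul_form_eq_zero h ρ hν 0
  have h1 := sum_ratio_mul_form_eq_zero h ρ hν 1
  rw [inner_hFlowVelocity, inner_adjugateHessian_eq_sum h hν, pow_two, mul_assoc, Finset.mul_sum]
  simp only [hinner, mul_sub, ← mul_assoc, hdN, covHessian_symm h.metric hf (∂ₛ p 1) (∂ₛ p 0),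
    Fin.sum_univ_three, mul_add] at h0 h1 ⊢
  linear_combination differential (ρ.localDensity p) p (∂ₛ p 0) * h1
    - differential (ρ.localDensity p) p (∂ₛ p 1) * h0

theorem inner_hFlowVelocity_normal (hf : ContMDiffAt (𝓡 2) (𝓡 4) 2 f p)
    (hinj : Function.Injective (push (m := 2) (n := 4) f p)) {ν : TangentSpace (𝓡 4) (f p)}
    (hν : ∀ v : TangentSpace (𝓡 2) p, h.metric.inner (f p) (push f p v) ν = 0) :
    h.metric.inner (f p) (hFlowVelocity ρ h f p) ν
      = areaRatio ρ h.metric f p ^ 2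
        * h.metric.inner (f p) (meanCurvature (m := 2) h.metric f p) ν := by
  rw [areaRatio_eq_sqrt, Real.sq_sqrt (Finset.sum_nonneg fun a _ => sq_nonneg _),
    sum_ratio_sq, div_mul_eq_mul_div, gramDet_mul_inner_meanCurvature hf hinj hν,
    ← density_sq_mul_inner_hFlowVelocity h ρ hf hν]
  exact (mul_div_cancel_left₀ _ (pow_ne_zero 2 (ρ.density_ne_zero p))).symm

theorem hFlowVelocity_eq_meanCurvatureVelocity (hf : ContMDiffAt (𝓡 2) (𝓡 4) 2 f p)
    (hinj : Function.Injective (push (m := 2) (n := 4) f p)) :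
    hFlowVelocity ρ h f p = meanCurvatureVelocity ρ h.metric f p := by
  refine eq_of_inner_push_eq_of_inner_normal_eq h.metric (m := 2) (fun v => ?_) (fun ν hν => ?_)
  · rw [inner_hFlowVelocity_push, ← areaRatio_mul_differential h ρ hf hinj]
    simp only [meanCurvatureVelocity, map_add, map_smul, add_apply, smul_apply, smul_eq_mul,
      inner_push_gradient _ hinj, inner_meanCurvature_push _ hinj, mul_zero, add_zero]
  · rw [inner_hFlowVelocity_normal h ρ hf hinj hν]
    simp only [meanCurvatureVelocity, map_add, map_smul, add_apply, smul_apply, smul_eq_mul, hν,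
      mul_zero, zero_add]

end Hyperkahler

end

end HFlow

theorem proposition2p1_general
    {S : Type*} [TopologicalSpace S] [ChartedSpace (EuclideanSpace ℝ (Fin 2)) S]
    [IsManifold (𝓡 2) ∞ S]
    {M : Type*} [TopologicalSpace M] [ChartedSpace (EuclideanSpace ℝ (Fin 4)) M]
    [IsManifold (𝓡 4) ∞ M]
    (ρ : HFlow.VolumeForm S) (h : HFlow.HyperkahlerStructure M) :
    (∀ (f : S → M) (p : S), ContMDiffAt (𝓡 2) (𝓡 4) 2 f p →
      Function.Injective (HFlow.push (m := 2) (n := 4) f p) →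
        HFlow.hFlowVelocity ρ h f p = HFlow.meanCurvatureVelocity ρ h.metric f p) ∧
    (∀ (T : Set ℝ) (F : ℝ → S → M), (∀ t ∈ T, ContMDiff (𝓡 2) (𝓡 4) 2 (F t)) →
      (∀ t ∈ T, ∀ p, Function.Injective (HFlow.push (m := 2) (n := 4) (F t) p)) →
        (HFlow.SolvesFlow (HFlow.hFlowVelocity ρ h) T F ↔
          HFlow.SolvesFlow (HFlow.meanCurvatureVelocity ρ h.metric) T F)) := by
  have hvelocity (f : S → M) (p : S) (hf : ContMDiffAt (𝓡 2) (𝓡 4) 2 f p)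
      (hinj : Function.Injective (HFlow.push (m := 2) (n := 4) f p)) :=
    HFlow.hFlowVelocity_eq_meanCurvatureVelocity h ρ hf hinj
  refine ⟨hvelocity, fun T F hF hinj => forall₂_congr fun t ht => forall_congr' fun p => ?_⟩
  rw [hvelocity (F t) p (hF t ht p) (hinj t ht p)]

theorem proposition2p1
    {S : Type*} [TopologicalSpace S] [ChartedSpace (EuclideanSpace ℝ (Fin 2)) S]
    [IsManifold (𝓡 2) ∞ S]
    {M : Type*} [TopologicalSpace M] [ChartedSpace (EuclideanSpace ℝ (Fin 4)) M]
    [IsManifold (𝓡 4) ∞ M]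
    (ρ : HFlow.VolumeForm S) (h : HFlow.HyperkahlerStructure M) :
    (∀ f : S → M, HFlow.IsSmoothImmersion 2 4 f → ∀ p : S,
      HFlow.hFlowVelocity ρ h f p = HFlow.meanCurvatureVelocity ρ h.metric f p) ∧
    (∀ (T : Set ℝ) (F : ℝ → S → M), (∀ t ∈ T, HFlow.IsSmoothImmersion 2 4 (F t)) →
      (HFlow.SolvesFlow (HFlow.hFlowVelocity ρ h) T F ↔
        HFlow.SolvesFlow (HFlow.meanCurvatureVelocity ρ h.metric) T F)) := by
  have hC2 {f : S → M} (hf : HFlow.IsSmoothImmersion 2 4 f) : ContMDiff (𝓡 2) (𝓡 4) 2 f :=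
    hf.smooth.of_le ENat.LEInfty.out
  exact ⟨fun f hf p => (proposition2p1_general ρ h).1 f p (hC2 hf p) (hf.injective p),
    fun T F hF => (proposition2p1_general ρ h).2 T F (fun t ht => hC2 (hF t ht))
      fun t ht => (hF t ht).injective⟩
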